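/- Let $A_0=\mathbb{R}$ with trivial conjugation and, for $n\ge 0$, let $A_{n+1}=A_n\times A_n$ be the Cayley–Dickson algebra with conjugation $(a,b)^*=(a^*,-b)$ and multiplication $(a,b)(c,d)=(ac-d^*b,\;da+bc^*)$; thus $A_3$ is the algebra of octonions and $A_4$ that of sedenions. Let $\operatorname{Re}(x)=\tfrac12(x+x^*)$, call $x$ imaginary if $\operatorname{Re}(x)=0$, and give $A_n$ the real inner product $\langle x,y\rangle=\operatorname{Re}(xy^*)$ and the norm $\|x\|=\sqrt{\langle x,x\rangle}$. For a non-zero $v\in A_n$, let $M_v:A_n\to A_n$ be the $\mathbb{R}$-linear map $M_v(x)=\|v\|^{-2}\,v^*(vx)$. The eigenvalues of $v$ and their multiplicities are the real eigenvalues of $M_v$ and the real dimensions of the corresponding eigenspaces. Let $a$ and $b$ be linearly independent imaginary elements of $A_3$, and let $\theta\in[0,\pi]$ be the angle between them. Then the eigenvalues of $(a,b)\in A_4$ are exactly $$1,\qquad 1+\frac{2\|a\|\,\|b\|\sin\theta}{\|a\|^2+\|b\|^2},\qquad 1-\frac{2\|a\|\,\|b\|\sin\theta}{\|a\|^2+\|b\|^2},$$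 with multiplicities $8$, $4$ and $4$ respectively. -/

import Mathlib

noncomputable section

/-- The underlying type of the real Cayley-Dickson algebra `A n`: `A 0 = ℝ` and
`A (n + 1) = A n × A n`. So `A 3` is the octonions and `A 4` is the sedenions. -/
def CayleyDickson : ℕ → Type
  | 0 => ℝ
  | n + 1 => CayleyDickson n × CayleyDickson n

namespace CayleyDickson

/-- The additive structure is componentwise. -/
@[reducible]
def addCommGroupAux : (n : ℕ) → AddCommGroup (CayleyDickson n)
  | 0 => inferInstanceAs (AddCommGroup ℝ)
  | n + 1 =>
    letI := addCommGroupAux n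
    inferInstanceAs (AddCommGroup (CayleyDickson n × CayleyDickson n))

instance instAddCommGroup (n : ℕ) : AddCommGroup (CayleyDickson n) := addCommGroupAux n

/-- Real scalars act componentwise. -/
@[reducible]
def moduleAux : (n : ℕ) → Module ℝ (CayleyDickson n)
  | 0 => inferInstanceAs (Module ℝ ℝ)
  | n + 1 =>
    letI := moduleAux n
    inferInstanceAs (Module ℝ (CayleyDickson n × CayleyDickson n))

instance instModule (n : ℕ) : Module ℝ (CayleyDickson n) := moduleAux n

/-- The element `(a, b)` of `A (n + 1)`, for `a` and `b` in `A n`. -/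
def pair {n : ℕ} (a b : CayleyDickson n) : CayleyDickson (n + 1) := (a, b)

/-- Conjugation: the identity on `A 0 = ℝ`, and `(a, b)* = (a*, -b)`. -/
def conj : (n : ℕ) → CayleyDickson n → CayleyDickson n
  | 0, x => x
  | n + 1, x => pair (conj n x.1) (-x.2)

/-- Multiplication: that of `ℝ` on `A 0`, and `(a, b)(c, d) = (ac - d*b, da + bc*)`. -/
def mul : (n : ℕ) → CayleyDickson n → CayleyDickson n → CayleyDickson n
  | 0, x, y => HMul.hMul (α := ℝ) (β := ℝ) (γ := ℝ) x y
  | n + 1, x, y =>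
    pair (mul n x.1 y.1 - mul n (conj n y.2) x.2) (mul n y.2 x.1 + mul n x.2 (conj n y.1))

/-- The unit: `1` on `A 0 = ℝ`, and `(1, 0)` on `A (n + 1)`. -/
def one : (n : ℕ) → CayleyDickson n
  | 0 => (1 : ℝ)
  | n + 1 => pair (one n) 0

instance instMul (n : ℕ) : Mul (CayleyDickson n) := ⟨mul n⟩
instance instOne (n : ℕ) : One (CayleyDickson n) := ⟨one n⟩
instance instStar (n : ℕ) : Star (CayleyDickson n) := ⟨conj n⟩

section Equations

variable {n : ℕ}

theorem pair_surj (x : CayleyDickson (n + 1)) : ∃ a b : CayleyDickson n, x = pair a b :=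
  ⟨x.1, x.2, rfl⟩

theorem pair_add (a b c d : CayleyDickson n) : pair a b + pair c d = pair (a + c) (b + d) := rfl

theorem smul_pair (r : ℝ) (a b : CayleyDickson n) : r • pair a b = pair (r • a) (r • b) := rfl

theorem zero_eq_pair : (0 : CayleyDickson (n + 1)) = pair 0 0 := rfl

theorem one_eq_pair : (1 : CayleyDickson (n + 1)) = pair 1 0 := rfl

theorem star_pair (a b : CayleyDickson n) : star (pair a b) = pair (star a) (-b) := rfl

theorem pair_mul (a b c d : CayleyDickson n) :
    pair a b * pair c d = pair (a * c - star d * b) (d * a + b * star c) := rfl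

theorem star_add' (x y : CayleyDickson n) : star (x + y) = star x + star y := by
  induction n with
  | zero => rfl
  | succ n ih =>
    obtain ⟨a, b, rfl⟩ := pair_surj x
    obtain ⟨c, d, rfl⟩ := pair_surj y
    simp only [pair_add, star_pair, ih, neg_add]

theorem star_smul' (r : ℝ) (x : CayleyDickson n) : star (r • x) = r • star x := by
  induction n with
  | zero => rfl
  | succ n ih =>
    obtain ⟨a, b, rfl⟩ := pair_surj x
    simp only [smul_pair, star_pair, ih, smul_neg]

theorem star_zero' : star (0 : CayleyDickson n) = 0 := by
  have h := star_smul' (0 : ℝ) (0 : CayleyDickson n)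
  simpa using h

theorem star_one' : star (1 : CayleyDickson n) = 1 := by
  induction n with
  | zero => rfl
  | succ n ih => simp only [one_eq_pair, star_pair, ih, neg_zero]

theorem distrib_aux (x y z : CayleyDickson n) :
    x * (y + z) = x * y + x * z ∧ (x + y) * z = x * z + y * z := by
  induction n with
  | zero => exact ⟨@mul_add ℝ _ _ _ x y z, @add_mul ℝ _ _ _ x y z⟩
  | succ n ih =>
    obtain ⟨a, b, rfl⟩ := pair_surj x
    obtain ⟨c, d, rfl⟩ := pair_surj y
    obtain ⟨e, f, rfl⟩ := pair_surj z
    have h1 := fun u v w : CayleyDickson n => (ih u v w).1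
    have h2 := fun u v w : CayleyDickson n => (ih u v w).2
    constructor <;>
    · simp only [pair_add, pair_mul, star_add', h1, h2]
      congr 1 <;> abel

theorem smul_aux (r : ℝ) (x y : CayleyDickson n) :
    (r • x) * y = r • (x * y) ∧ x * (r • y) = r • (x * y) := by
  induction n with
  | zero => exact ⟨@mul_assoc ℝ _ r x y, @mul_left_comm ℝ _ x r y⟩
  | succ n ih =>
    obtain ⟨a, b, rfl⟩ := pair_surj x
    obtain ⟨c, d, rfl⟩ := pair_surj y
    have h1 := fun u v : CayleyDickson n => (ih u v).1
    have h2 := fun u v : CayleyDickson n => (ih u v).2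
    constructor <;>
    · simp only [smul_pair, pair_mul, star_smul', h1, h2, smul_sub, smul_add]

theorem zero_mul_aux (x : CayleyDickson n) : 0 * x = 0 := by
  simpa using (smul_aux (0 : ℝ) 0 x).1

theorem mul_zero_aux (x : CayleyDickson n) : x * 0 = 0 := by
  simpa using (smul_aux (0 : ℝ) x 0).2

theorem one_mul_aux (x : CayleyDickson n) : 1 * x = x ∧ x * 1 = x := by
  induction n with
  | zero => exact ⟨@one_mul ℝ _ x, @mul_one ℝ _ x⟩
  | succ n ih =>
    obtain ⟨a, b, rfl⟩ := pair_surj x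
    simp only [one_eq_pair, pair_mul, star_one', star_zero', zero_mul_aux, mul_zero_aux,
      fun u : CayleyDickson n => (ih u).1, fun u : CayleyDickson n => (ih u).2, sub_zero, add_zero,
      zero_add, and_self]

end Equations

instance instNonAssocRing (n : ℕ) : NonAssocRing (CayleyDickson n) where
  __ := instAddCommGroup n
  left_distrib x y z := (distrib_aux x y z).1
  right_distrib x y z := (distrib_aux x y z).2
  zero_mul := zero_mul_aux
  mul_zero := mul_zero_aux
  one_mul x := (one_mul_aux x).1
  mul_one x := (one_mul_aux x).2

instance instIsScalarTower (n : ℕ) : IsScalarTower ℝ (CayleyDickson n) (CayleyDickson n) :=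
  ⟨fun r x y => (smul_aux r x y).1⟩

instance instSMulCommClass (n : ℕ) : SMulCommClass ℝ (CayleyDickson n) (CayleyDickson n) :=
  ⟨fun r x y => (smul_aux r x y).2.symm⟩

/-- The real part `Re(x) = (x + x*) / 2`, as an element of `A n`. -/
def rePart {n : ℕ} (x : CayleyDickson n) : CayleyDickson n := (1 / 2 : ℝ) • (x + star x)

/-- `x` is imaginary if its real part vanishes. -/
def IsImaginary {n : ℕ} (x : CayleyDickson n) : Prop := rePart x = 0

/-- The real number `r` with `Re(x) = r • 1` (see `rePart_eq`). -/
def re : (n : ℕ) → CayleyDickson n → ℝ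
  | 0, x => x
  | n + 1, x => re n x.1

theorem rePart_eq {n : ℕ} (x : CayleyDickson n) : rePart x = re n x • (1 : CayleyDickson n) := by
  induction n with
  | zero =>
    have h : ∀ u : ℝ, (1 / 2 : ℝ) * (u + u) = u * 1 := fun u => by ring
    exact h x
  | succ n ih =>
    obtain ⟨a, b, rfl⟩ := pair_surj x
    have h := ih a
    rw [rePart] at h ⊢
    rw [star_pair, pair_add, smul_pair, h, one_eq_pair, smul_pair, add_neg_cancel, smul_zero,
      smul_zero]
    rfl

theorem re_add {n : ℕ} (x y : CayleyDickson n) : re n (x + y) = re n x + re n y := by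
  induction n with
  | zero => rfl
  | succ n ih => exact ih x.1 y.1

theorem re_smul {n : ℕ} (r : ℝ) (x : CayleyDickson n) : re n (r • x) = r * re n x := by
  induction n with
  | zero => rfl
  | succ n ih => exact ih x.1

/-- The real inner product `⟨a, b⟩ = Re(a b*)`. -/
instance instInner (n : ℕ) : Inner ℝ (CayleyDickson n) := ⟨fun a b => re n (a * star b)⟩

theorem inner_def {n : ℕ} (a b : CayleyDickson n) : inner ℝ a b = re n (a * star b) := rfl

theorem inner_aux {n : ℕ} (a b : CayleyDickson n) :
    re n (star a * b) = re n (a * star b) ∧ re n (b * star a) = re n (a * star b) := by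
  induction n with
  | zero => exact ⟨rfl, @mul_comm ℝ _ b a⟩
  | succ n ih =>
    obtain ⟨a, a', rfl⟩ := pair_surj a
    obtain ⟨b, b', rfl⟩ := pair_surj b
    have e : ∀ u v : CayleyDickson n, re (n + 1) (pair u v) = re n u := fun _ _ => rfl
    have s : ∀ u : CayleyDickson n, star (-u) = -star u := fun u => by
      simpa using star_smul' (-1 : ℝ) u
    have := ih a b
    have h1 := ih a' b'
    have h2 := ih b' a'
    simp only [star_pair, pair_mul, e, s, mul_neg, neg_mul, sub_neg_eq_add, re_add]
    exact ⟨by rw [this.1], by rw [this.2, h1.1, h2.1, h1.2]⟩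

/-- The inner product on `A (n + 1) = A n × A n` is the sum of those of the components. -/
theorem inner_pair {n : ℕ} (a b c d : CayleyDickson n) :
    inner ℝ (pair a b) (pair c d) = inner ℝ a c + inner ℝ b d := by
  have e : ∀ u v : CayleyDickson n, re (n + 1) (pair u v) = re n u := fun _ _ => rfl
  have s : star (-d) = -star d := by simpa using star_smul' (-1 : ℝ) d
  simp only [inner_def, star_pair, pair_mul, e, s, neg_mul, sub_neg_eq_add, re_add]
  rw [(inner_aux d b).1, (inner_aux b d).2]

theorem inner_self_aux {n : ℕ} (a : CayleyDickson n) :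
    0 ≤ inner ℝ a a ∧ (inner ℝ a a = 0 → a = 0) := by
  induction n with
  | zero =>
    have h : ∀ u : ℝ, 0 ≤ u * u ∧ (u * u = 0 → u = 0) :=
      fun u => ⟨mul_self_nonneg u, mul_self_eq_zero.1⟩
    exact h a
  | succ n ih =>
    obtain ⟨a, b, rfl⟩ := pair_surj a
    rw [inner_pair]
    refine ⟨add_nonneg (ih a).1 (ih b).1, fun h => ?_⟩
    have h1 := (ih a).1
    have h2 := (ih b).1
    rw [(ih a).2 (by linarith), (ih b).2 (by linarith)]
    rfl

/-- `A n` is a positive-definite real inner product space under `Re(a b*)`. -/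
@[reducible]
def innerCore (n : ℕ) : InnerProductSpace.Core ℝ (CayleyDickson n) where
  inner := inner ℝ
  conj_inner_symm x y := (inner_aux x y).2
  re_inner_nonneg x := (inner_self_aux x).1
  add_left x y z := by simp only [inner_def, add_mul, re_add]
  smul_left x y r := by simp only [inner_def, (smul_aux r _ _).1, re_smul]; rfl
  definite x := (inner_self_aux x).2

/-- The norm is `‖a‖ = √⟨a, a⟩`. -/
instance instNormedAddCommGroup (n : ℕ) : NormedAddCommGroup (CayleyDickson n) :=
  (innerCore n).toNormedAddCommGroup

instance instInnerProductSpace (n : ℕ) : InnerProductSpace ℝ (CayleyDickson n) :=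
  InnerProductSpace.ofCore (innerCore n).toCore

/-- The operator `M_a = ‖a‖⁻² L_{a*} L_a` on `A n`, where `L_a` is left multiplication by `a`;
the eigenvalues of `a` are those of `M_a`. -/
def M {n : ℕ} (a : CayleyDickson n) : Module.End ℝ (CayleyDickson n) :=
  (1 / ‖a‖ ^ 2) • (LinearMap.mulLeft ℝ (star a) ∘ₗ LinearMap.mulLeft ℝ a)

end CayleyDickson

end

/-! Let `T x = (ab)x - a(bx)` be the associator map on the octonions and `N = ‖a‖² + ‖b‖²`.
Alternativity makes the associator alternating, so `M` acts on `A 3 × A 3` by `(x, y) ↦ (x - N⁻¹ T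
y, y + N⁻¹ T x)` (`M_pair`). With `ν = N(μ - 1)`, the eigenvector equation for `μ` becomes `T x = ν
y`, `T y = -ν x`.

Everything thus depends on `T` (`associatorMap_spec`). Since `T` is unchanged when a multiple of `a`
is added to `b`, one may take `a ⟂ b`. Then `U = L_{ab}` and `V = L_a L_b` commute and have the same
scalar square `-‖a‖²‖b‖²`, so `T = U - V` and `R = U + V` have product zero and complementary
kernels. Left multiplication by some `c ⟂ 1, a, b, ab` exchanges these kernels, so each has
dimension 4; on `ker R`, `T = 2U`. Undoing the orthogonalisation gives `T² = -s²` there, with `s =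
2‖a‖‖b‖ sin θ`.

Hence `ν = 0` has eigenspace `ker T × ker T`, while `ν = ±s` have the graphs of `±s⁻¹ T` over `ker
R`; `T³ = -s² T` excludes other values. -/

namespace CayleyDickson

/-! ### Conjugation, norms and imaginary elements -/

section Star

variable {n : ℕ}

theorem star_neg' (x : CayleyDickson n) : star (-x) = -star x := by
  simpa using star_smul' (-1 : ℝ) x

theorem star_sub' (x y : CayleyDickson n) : star (x - y) = star x - star y := by
  rw [sub_eq_add_neg, star_add', star_neg', sub_eq_add_neg]

theorem star_star' (x : CayleyDickson n) : star (star x) = x := by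
  induction n with
  | zero => rfl
  | succ n ih =>
    obtain ⟨a, b, rfl⟩ := pair_surj x
    simp only [star_pair, ih, neg_neg]

theorem neg_pair (a b : CayleyDickson n) : -pair a b = pair (-a) (-b) := rfl

theorem star_mul' (x y : CayleyDickson n) : star (x * y) = star y * star x := by
  induction n with
  | zero => exact @mul_comm ℝ _ x y
  | succ n ih =>
    obtain ⟨a, b, rfl⟩ := pair_surj x
    obtain ⟨c, d, rfl⟩ := pair_surj y
    simp only [pair_mul, star_pair, ih, star_sub', star_neg', star_star', mul_neg, neg_mul, neg_neg]
    congr 1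
    abel

theorem star_eq (x : CayleyDickson n) : star x = (2 * re n x) • (1 : CayleyDickson n) - x := by
  have h := rePart_eq x
  rw [rePart] at h
  rw [mul_smul, ← h, smul_smul]
  norm_num

theorem IsImaginary.star_eq_neg {x : CayleyDickson n} (hx : x.IsImaginary) : star x = -x := by
  have h : (2 : ℝ) • ((1 / 2 : ℝ) • (x + star x)) = (2 : ℝ) • (0 : CayleyDickson n) :=
    congrArg _ hx
  rw [smul_smul, smul_zero] at h
  norm_num at h
  exact (neg_eq_of_add_eq_zero_right h).symm

theorem isImaginary_of_star_eq_neg {x : CayleyDickson n} (hx : star x = -x) : x.IsImaginary := by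
  rw [IsImaginary, rePart, hx, add_neg_cancel, smul_zero]

theorem inner_one (x : CayleyDickson n) : inner ℝ x 1 = re n x := by
  rw [inner_def, star_one', mul_one]

theorem isImaginary_of_inner_one {x : CayleyDickson n} (hx : inner ℝ x 1 = 0) :
    x.IsImaginary := by
  rw [IsImaginary, rePart_eq, ← inner_one, hx, zero_smul]

theorem norm_sq_pair (a b : CayleyDickson n) : ‖pair a b‖ ^ 2 = ‖a‖ ^ 2 + ‖b‖ ^ 2 := by
  simp only [← real_inner_self_eq_norm_sq]
  exact inner_pair a b a b

/-- `x x*` is fixed by conjugation, hence equals its real part; `x*` is a scalar minus `x`, so it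
commutes with `x`. -/
theorem mul_star_self_aux (x : CayleyDickson n) :
    x * star x = ‖x‖ ^ 2 • (1 : CayleyDickson n) ∧
      star x * x = ‖x‖ ^ 2 • (1 : CayleyDickson n) := by
  have key : x * star x = ‖x‖ ^ 2 • (1 : CayleyDickson n) := by
    have h := star_eq (x * star x)
    rw [star_mul', star_star', eq_sub_iff_add_eq, ← two_smul ℝ, mul_smul] at h
    rw [← real_inner_self_eq_norm_sq]
    exact smul_right_injective _ (two_ne_zero (α := ℝ)) h
  refine ⟨key, ?_⟩
  rw [← key, star_eq]
  simp only [mul_sub, sub_mul, smul_mul_assoc, mul_smul_comm, one_mul, mul_one]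

theorem mul_star_self' (x : CayleyDickson n) :
    x * star x = ‖x‖ ^ 2 • (1 : CayleyDickson n) := (mul_star_self_aux x).1

theorem star_mul_self' (x : CayleyDickson n) :
    star x * x = ‖x‖ ^ 2 • (1 : CayleyDickson n) := (mul_star_self_aux x).2

theorem IsImaginary.mul_self {x : CayleyDickson n} (hx : x.IsImaginary) :
    x * x = -(‖x‖ ^ 2 • (1 : CayleyDickson n)) := by
  rw [← mul_star_self', hx.star_eq_neg, mul_neg, neg_neg]

theorem IsImaginary.add {x y : CayleyDickson n} (hx : x.IsImaginary) (hy : y.IsImaginary) :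
    (x + y).IsImaginary := by
  apply isImaginary_of_star_eq_neg
  rw [star_add', hx.star_eq_neg, hy.star_eq_neg, neg_add]

theorem IsImaginary.smul {x : CayleyDickson n} (r : ℝ) (hx : x.IsImaginary) :
    (r • x).IsImaginary := by
  apply isImaginary_of_star_eq_neg
  rw [star_smul', hx.star_eq_neg, smul_neg]

/-- Polarise `x² = -‖x‖²`. -/
theorem IsImaginary.mul_eq_neg_mul {x y : CayleyDickson n} (hx : x.IsImaginary)
    (hy : y.IsImaginary) (h : inner ℝ x y = 0) : y * x = -(x * y) := by
  have h1 := (hx.add hy).mul_self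
  rw [norm_add_sq_real, h, add_mul, mul_add, mul_add, hx.mul_self, hy.mul_self] at h1
  rw [eq_neg_iff_add_eq_zero]
  simp only [mul_zero, add_zero, add_smul] at h1
  calc y * x + x * y
      = (-(‖x‖ ^ 2 • (1 : CayleyDickson n)) + x * y + (y * x + -(‖y‖ ^ 2 • 1)))
        + (‖x‖ ^ 2 • 1 + ‖y‖ ^ 2 • 1) := by abel
    _ = 0 := by rw [h1, neg_add_cancel]

theorem IsImaginary.mul {x y : CayleyDickson n} (hx : x.IsImaginary)
    (hy : y.IsImaginary) (h : inner ℝ x y = 0) : (x * y).IsImaginary := by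
  apply isImaginary_of_star_eq_neg
  rw [star_mul', hx.star_eq_neg, hy.star_eq_neg, neg_mul_neg, hx.mul_eq_neg_mul hy h]

end Star

/-! ### From commutative to alternative: `A 1`, `A 2`, `A 3` -/

section Alternative

theorem mul_comm_one (x y : CayleyDickson 1) : x * y = y * x := by
  obtain ⟨a, b, rfl⟩ := pair_surj x
  obtain ⟨c, d, rfl⟩ := pair_surj y
  have hs : ∀ u : CayleyDickson 0, star u = u := fun _ => rfl
  have hc : ∀ u v : CayleyDickson 0, u * v = v * u := fun u v => @mul_comm ℝ _ u v
  simp only [pair_mul, hs]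
  rw [hc a c, hc d b, add_comm (d * a), hc b c, hc d a]

theorem mul_assoc_one (x y z : CayleyDickson 1) : x * y * z = x * (y * z) := by
  obtain ⟨a, b, rfl⟩ := pair_surj x
  obtain ⟨c, d, rfl⟩ := pair_surj y
  obtain ⟨e, f, rfl⟩ := pair_surj z
  have hs : ∀ u : CayleyDickson 0, star u = u := fun _ => rfl
  have hc : ∀ u v : CayleyDickson 0, u * v = v * u := fun u v => @mul_comm ℝ _ u v
  have ha : ∀ u v w : CayleyDickson 0, u * v * w = u * (v * w) :=
    fun u v w => @mul_assoc ℝ _ u v w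
  have hl : ∀ u v w : CayleyDickson 0, u * (v * w) = v * (u * w) :=
    fun u v w => @mul_left_comm ℝ _ u v w
  simp only [pair_mul, hs, mul_add, mul_sub, hc, hl]
  congr 1 <;> abel

theorem mul_assoc_two (x y z : CayleyDickson 2) : x * y * z = x * (y * z) := by
  obtain ⟨a, b, rfl⟩ := pair_surj x
  obtain ⟨c, d, rfl⟩ := pair_surj y
  obtain ⟨e, f, rfl⟩ := pair_surj z
  have hl : ∀ u v w : CayleyDickson 1, u * (v * w) = v * (u * w) := fun u v w => by
    rw [← mul_assoc_one, mul_comm_one u, mul_assoc_one]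
  simp only [pair_mul, star_add', star_sub', star_mul', star_star', mul_add, mul_sub, add_mul,
    sub_mul, mul_assoc_one, mul_comm_one, hl]
  congr 1 <;> abel

/-- The quaternion components associate, and `a + a*` and `b b*` are real, hence central. -/
theorem mul_mul_self_left (x y : CayleyDickson 3) : x * (x * y) = x * x * y := by
  obtain ⟨a, b, rfl⟩ := pair_surj x
  obtain ⟨c, d, rfl⟩ := pair_surj y
  have h2 : ∀ u, b * (star b * u) = ‖b‖ ^ 2 • u := fun u => by
    rw [← mul_assoc_two, mul_star_self', smul_mul_assoc, one_mul]
  simp only [pair_mul, star_add', star_sub', star_mul', star_star', mul_add, mul_sub, add_mul,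
    sub_mul, mul_assoc_two, h2, star_mul_self', mul_smul_comm, mul_one]
  rw [star_eq a]
  simp only [mul_sub, sub_mul, smul_mul_assoc, mul_smul_comm, one_mul, mul_one]
  congr 1 <;> abel

theorem mul_mul_self_right (x y : CayleyDickson 3) : y * x * x = y * (x * x) := by
  have h := congrArg star (mul_mul_self_left (star x) (star y))
  simpa only [star_mul', star_star'] using h

theorem mul_mul_add_left (x y z : CayleyDickson 3) :
    x * (y * z) + y * (x * z) = (x * y + y * x) * z := by
  have h := mul_mul_self_left (x + y) z
  simp only [add_mul, mul_add, mul_mul_self_left x, mul_mul_self_left y] at h ⊢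
  have h' := congrArg (· - (x * x * z + y * y * z)) h
  convert h' using 1 <;> abel

theorem mul_mul_add_right (x y z : CayleyDickson 3) :
    z * x * y + z * y * x = z * (x * y + y * x) := by
  have h := mul_mul_self_right (x + y) z
  simp only [add_mul, mul_add, mul_mul_self_right x, mul_mul_self_right y] at h ⊢
  have h' := congrArg (· - (z * (x * x) + z * (y * y))) h
  convert h' using 1 <;> abel

end Alternative

/-! ### The associator map and its relation to `M` -/

/-- The map `x ↦ [a, b, x] = (ab)x - a(bx)`. -/
def associatorMap (a b : CayleyDickson 3) : Module.End ℝ (CayleyDickson 3) :=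
  LinearMap.mulLeft ℝ (a * b) - LinearMap.mulLeft ℝ a * LinearMap.mulLeft ℝ b

theorem associatorMap_apply (a b x : CayleyDickson 3) :
    associatorMap a b x = a * b * x - a * (b * x) := rfl

/-- Holds because `[a, a, x] = 0`; it permits replacing `b` by its component orthogonal to `a`. -/
theorem associatorMap_add_smul (a b : CayleyDickson 3) (r : ℝ) :
    associatorMap a (b + r • a) = associatorMap a b := by
  ext1 x
  simp only [associatorMap_apply, mul_add, add_mul, mul_smul_comm, smul_mul_assoc,
    mul_mul_self_left]
  abel

theorem pair_mul_pair_mul {a b : CayleyDickson 3} (ha : a.IsImaginary) (hb : b.IsImaginary)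
    (x y : CayleyDickson 3) :
    pair a b * (pair a b * pair x y) =
      pair (-((‖a‖ ^ 2 + ‖b‖ ^ 2) • x) + associatorMap a b y)
        (-((‖a‖ ^ 2 + ‖b‖ ^ 2) • y) - associatorMap a b x) := by
  have h1 := mul_mul_add_right b y a
  have h2 := mul_mul_add_left a b x
  have h3 := mul_mul_add_right a x b
  have h1' : a * y * b - a * (y * b) = -associatorMap a b y := by
    rw [associatorMap_apply, ← sub_eq_zero]
    rw [mul_add, ← sub_eq_zero] at h1
    rw [← h1]; abel
  have h2' : b * x * a - b * (x * a) = associatorMap a b x := by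
    rw [associatorMap_apply, ← sub_eq_zero]
    rw [add_mul, ← sub_eq_zero] at h2
    rw [mul_add, ← sub_eq_zero] at h3
    -- The goal is the sum of `h3` and `h2`; splitting `0` makes room for both.
    rw [← add_zero (0 : CayleyDickson 3)]
    nth_rw 1 [← h3]
    rw [← h2]; abel
  simp only [pair_mul, star_add', star_sub', star_mul', star_star', ha.star_eq_neg,
    hb.star_eq_neg]
  -- The real parts of `x` and `y` associate with everything and cancel, leaving associators.
  rw [star_eq x, star_eq y]
  simp only [mul_sub, add_mul, sub_mul, neg_mul, mul_neg, smul_neg, mul_smul_comm, smul_mul_assoc,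
    one_mul, mul_one, mul_mul_self_left, mul_mul_self_right, ha.mul_self, hb.mul_self, add_smul]
  rw [← neg_neg (associatorMap a b y), ← h1', ← h2']
  congr 1 <;> abel

theorem M_pair {a b : CayleyDickson 3} (ha : a.IsImaginary) (hb : b.IsImaginary)
    (h0 : ‖a‖ ^ 2 + ‖b‖ ^ 2 ≠ 0) (x y : CayleyDickson 3) :
    (pair a b).M (pair x y) =
      pair (x - (1 / (‖a‖ ^ 2 + ‖b‖ ^ 2)) • associatorMap a b y)
        (y + (1 / (‖a‖ ^ 2 + ‖b‖ ^ 2)) • associatorMap a b x) := by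
  have h : (pair a b).M (pair x y) =
      (1 / ‖pair a b‖ ^ 2) • (star (pair a b) * (pair a b * pair x y)) := rfl
  have hs : star (pair a b) = -pair a b := by rw [star_pair, ha.star_eq_neg, neg_pair]
  rw [h, hs, neg_mul, pair_mul_pair_mul ha hb, norm_sq_pair, neg_pair, smul_pair]
  simp only [neg_add, neg_sub, neg_neg, smul_add, smul_neg, smul_smul,
    one_div_mul_cancel h0, one_smul, sub_neg_eq_add]
  congr 1
  abel

end CayleyDickson

/-! ### Kernels of complementary operators -/

section LinearAlgebra

open Module

variable {V : Type*} [AddCommGroup V] [Module ℝ V] [FiniteDimensional ℝ V]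

/-- If `R * T = 0` and `T + R` is injective, then `T` and `R` have kernels of complementary
dimensions. -/
theorem finrank_ker_add_finrank_ker_eq {T R : End ℝ V} (hRT : R * T = 0)
    (hinj : Function.Injective (T + R)) :
    finrank ℝ (LinearMap.ker T) + finrank ℝ (LinearMap.ker R) = finrank ℝ V := by
  apply le_antisymm
  · rw [← Submodule.finrank_sup_add_finrank_inf_eq]
    have : LinearMap.ker T ⊓ LinearMap.ker R = ⊥ := by
      rw [Submodule.eq_bot_iff]
      rintro x ⟨hx, hy⟩
      apply hinj
      rw [LinearMap.add_apply, LinearMap.mem_ker.1 hx, LinearMap.mem_ker.1 hy, map_zero, add_zero]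
    rw [this, finrank_bot, add_zero]
    exact Submodule.finrank_le _
  -- Rank-nullity, as `R * T = 0` puts the range of `T` inside `ker R`.
  · rw [← LinearMap.finrank_range_add_finrank_ker T, add_comm]
    gcongr
    apply Submodule.finrank_mono
    rintro _ ⟨x, rfl⟩
    exact LinearMap.congr_fun hRT x

theorem finrank_ker_le_of_mul_eq_neg {T R C : End ℝ V} (hC : Function.Injective C)
    (h : R * C = -(C * T)) : finrank ℝ (LinearMap.ker T) ≤ finrank ℝ (LinearMap.ker R) := by
  rw [(Submodule.equivMapOfInjective C hC _).finrank_eq]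
  apply Submodule.finrank_mono
  rintro _ ⟨x, hx, rfl⟩
  have h' := LinearMap.congr_fun h x
  simpa [LinearMap.mem_ker.1 hx] using h'

end LinearAlgebra

/-! ### Products of anticommuting operators -/

section Anticommuting

variable {S : Type*} [Ring S] {A B U : S}

theorem commute_mul_of_anticommute (hUA : U * A = -(A * U)) (hUB : U * B = -(B * U)) :
    U * (A * B) = A * B * U := by
  rw [← mul_assoc, hUA, neg_mul, mul_assoc, hUB, mul_neg, neg_neg, mul_assoc]

theorem mul_mul_self_of_anticommute [Algebra ℝ S] {α β : ℝ} (hA : A * A = -algebraMap ℝ S α)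
    (hB : B * B = -algebraMap ℝ S β) (hBA : B * A = -(A * B)) :
    A * B * (A * B) = -algebraMap ℝ S (α * β) := by
  rw [mul_assoc, ← mul_assoc B, hBA, neg_mul, mul_neg, mul_assoc A B B, hB, ← mul_assoc, hA,
    neg_mul_neg, map_mul]

end Anticommuting

/-! ### Kernel and square of the associator map -/

namespace CayleyDickson

open Module

instance instFiniteDimensional (n : ℕ) : FiniteDimensional ℝ (CayleyDickson n) := by
  induction n with
  | zero => exact inferInstanceAs (FiniteDimensional ℝ ℝ)
  | succ n ih => exact inferInstanceAs (FiniteDimensional ℝ (CayleyDickson n × CayleyDickson n))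

theorem finrank_eq (n : ℕ) : finrank ℝ (CayleyDickson n) = 2 ^ n := by
  induction n with
  | zero => exact finrank_self ℝ
  | succ n ih =>
    have h : finrank ℝ (CayleyDickson n × CayleyDickson n) = 2 ^ (n + 1) := by
      rw [finrank_prod, ih]; ring
    exact h

theorem mulLeft_mul_self {a : CayleyDickson 3} (ha : a.IsImaginary) :
    LinearMap.mulLeft ℝ a * LinearMap.mulLeft ℝ a = -algebraMap ℝ (End ℝ _) (‖a‖ ^ 2) := by
  ext1 x
  change a * (a * x) = -(‖a‖ ^ 2 • x)
  rw [mul_mul_self_left, ha.mul_self, neg_mul, smul_mul_assoc, one_mul]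

theorem mulLeft_mul_eq_neg {a b : CayleyDickson 3} (h : b * a = -(a * b)) :
    LinearMap.mulLeft ℝ b * LinearMap.mulLeft ℝ a =
      -(LinearMap.mulLeft ℝ a * LinearMap.mulLeft ℝ b) := by
  ext1 x
  change b * (a * x) = -(a * (b * x))
  rw [eq_neg_iff_add_eq_zero, mul_mul_add_left, h, neg_add_cancel, zero_mul]

theorem injective_of_mul_self {n : ℕ} {C : End ℝ (CayleyDickson n)} {r : ℝ} (hr : r ≠ 0)
    (h : C * C = -algebraMap ℝ (End ℝ _) r) : Function.Injective C := by
  rw [injective_iff_map_eq_zero]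
  intro x hx
  have h' : C (C x) = -(r • x) := LinearMap.congr_fun h x
  rw [hx, map_zero, zero_eq_neg, smul_eq_zero] at h'
  exact h'.resolve_left hr

/-- Four linear conditions on an 8-dimensional space. -/
theorem exists_inner_eq_zero (u v w z : CayleyDickson 3) :
    ∃ c : CayleyDickson 3, c ≠ 0 ∧ inner ℝ c u = 0 ∧ inner ℝ c v = 0 ∧ inner ℝ c w = 0 ∧
      inner ℝ c z = 0 := by
  let f : CayleyDickson 3 →ₗ[ℝ] Fin 4 → ℝ :=
    LinearMap.pi fun i => (innerₗ (CayleyDickson 3)) (![u, v, w, z] i)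
  have hf : LinearMap.ker f ≠ ⊥ := by
    apply LinearMap.ker_ne_bot_of_finrank_lt
    rw [finrank_eq, finrank_fin_fun]
    norm_num
  obtain ⟨c, hc, hc0⟩ := (Submodule.ne_bot_iff _).1 hf
  have h : ∀ i, inner ℝ c (![u, v, w, z] i) = 0 := fun i => by
    rw [real_inner_comm]
    exact congrFun (LinearMap.mem_ker.1 hc) i
  exact ⟨c, hc0, h 0, h 1, h 2, h 3⟩

theorem associatorMap_spec_of_inner_eq_zero {a b : CayleyDickson 3} (ha : a.IsImaginary)
    (hb : b.IsImaginary) (hab : inner ℝ a b = 0) (ha0 : a ≠ 0) (hb0 : b ≠ 0) :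
    ∃ R : End ℝ (CayleyDickson 3), finrank ℝ (LinearMap.ker (associatorMap a b)) = 4 ∧
      finrank ℝ (LinearMap.ker R) = 4 ∧ R * associatorMap a b = 0 ∧
      ∀ x, R x = 0 → associatorMap a b (associatorMap a b x) =
        -((4 * (‖a‖ ^ 2 * ‖b‖ ^ 2)) • x) := by
  have hba := ha.mul_eq_neg_mul hb hab
  have hq : ‖a‖ ^ 2 * ‖b‖ ^ 2 ≠ 0 := by
    have := norm_ne_zero_iff.2 ha0
    have := norm_ne_zero_iff.2 hb0
    positivity
  have haab : a * (a * b) = -(‖a‖ ^ 2 • b) := by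
    rw [mul_mul_self_left, ha.mul_self, neg_mul, smul_mul_assoc, one_mul]
  have haba : a * b * a = -(a * (a * b)) := by
    rw [haab, ← neg_neg (a * b), ← hba, neg_mul, mul_mul_self_right, ha.mul_self, mul_neg,
      mul_smul_comm, mul_one]
  have habb : a * b * b = -(‖b‖ ^ 2 • a) := by
    rw [mul_mul_self_right, hb.mul_self, mul_neg, mul_smul_comm, mul_one]
  have habb' : a * b * b = -(b * (a * b)) := by
    rw [habb, ← neg_neg (a * b), ← hba, mul_neg, mul_mul_self_left, hb.mul_self, neg_mul,
      smul_mul_assoc, one_mul, neg_neg]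
  have habab : a * b * (a * b) = -((‖a‖ ^ 2 * ‖b‖ ^ 2) • 1) := by
    -- As `ab` anticommutes with `a`, `(ab)(ab) = -a((ab)b)`.
    have h := mul_mul_add_left (a * b) a b
    rw [haba, neg_add_cancel, zero_mul, habb, mul_neg, mul_smul_comm, ha.mul_self, smul_neg,
      neg_neg, smul_smul] at h
    rw [eq_neg_iff_add_eq_zero, mul_comm (‖a‖ ^ 2)]
    exact h
  -- `L_c` anticommutes with `L_a`, `L_b` and `U`, hence commutes with `V = L_a L_b`: it turns `U -
  -- V` into `-(U + V)`.
  obtain ⟨c, hc0, hc1, hca, hcb, hcab⟩ := exists_inner_eq_zero 1 a b (a * b)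
  have hc : c.IsImaginary := isImaginary_of_inner_one hc1
  have hA := mulLeft_mul_self ha
  have hB := mulLeft_mul_self hb
  have hC := mulLeft_mul_self hc
  have hBA := mulLeft_mul_eq_neg hba
  have hUA := mulLeft_mul_eq_neg haba
  have hUB := mulLeft_mul_eq_neg habb'
  have hU : LinearMap.mulLeft ℝ (a * b) * LinearMap.mulLeft ℝ (a * b) =
      -algebraMap ℝ (End ℝ _) (‖a‖ ^ 2 * ‖b‖ ^ 2) := by
    ext1 x
    change a * b * (a * b * x) = -((‖a‖ ^ 2 * ‖b‖ ^ 2) • x)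
    rw [mul_mul_self_left, habab, neg_mul, smul_mul_assoc, one_mul]
  have hAC := mulLeft_mul_eq_neg (hc.mul_eq_neg_mul ha hca)
  have hBC := mulLeft_mul_eq_neg (hc.mul_eq_neg_mul hb hcb)
  have hUC := mulLeft_mul_eq_neg (hc.mul_eq_neg_mul (ha.mul hb hab) hcab)
  have hUinj := injective_of_mul_self hq hU
  have hCinj := injective_of_mul_self (pow_ne_zero 2 (norm_ne_zero_iff.2 hc0)) hC
  have hV := mul_mul_self_of_anticommute hA hB hBA
  have hUV := commute_mul_of_anticommute hUA hUB
  have hVC : LinearMap.mulLeft ℝ a * LinearMap.mulLeft ℝ b * LinearMap.mulLeft ℝ c =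
      LinearMap.mulLeft ℝ c * (LinearMap.mulLeft ℝ a * LinearMap.mulLeft ℝ b) := by
    rw [mul_assoc, hBC, mul_neg, ← mul_assoc, hAC, neg_mul, neg_neg, mul_assoc]
  have hT : associatorMap a b =
    LinearMap.mulLeft ℝ (a * b) - LinearMap.mulLeft ℝ a * LinearMap.mulLeft ℝ b := rfl
  -- From here only the relations among `U`, `V` and `C` matter.
  generalize LinearMap.mulLeft ℝ a * LinearMap.mulLeft ℝ b = V at *
  generalize LinearMap.mulLeft ℝ (a * b) = U at *
  generalize LinearMap.mulLeft ℝ c = C at *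
  generalize associatorMap a b = T at *
  subst hT
  have hRT : (U + V) * (U - V) = 0 := by
    rw [add_mul, mul_sub, mul_sub, hUV, hU, hV]; abel
  have hTR : (U - V) + (U + V) = (2 : ℝ) • U := by rw [two_smul]; abel
  have hsum := finrank_ker_add_finrank_ker_eq hRT (by
    rw [hTR]
    exact fun x y h => hUinj (smul_right_injective _ (two_ne_zero (α := ℝ)) h))
  have hle := finrank_ker_le_of_mul_eq_neg (T := U - V) (R := U + V) hCinj (by
    rw [add_mul, mul_sub, hUC, hVC]; abel)
  have hge := finrank_ker_le_of_mul_eq_neg (T := U + V) (R := U - V) hCinj (by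
    rw [sub_mul, mul_add, hUC, hVC]; abel)
  rw [finrank_eq] at hsum
  refine ⟨U + V, by omega, by omega, hRT, fun x hx => ?_⟩
  have h1 : V x = -U x := eq_neg_of_add_eq_zero_right hx
  have h2 : U (U x) = -((‖a‖ ^ 2 * ‖b‖ ^ 2) • x) := LinearMap.congr_fun hU x
  have h3 : U (V x) = V (U x) := LinearMap.congr_fun hUV x
  simp only [LinearMap.sub_apply, map_sub, ← h3, h1, map_neg, h2]
  module

theorem associatorMap_spec {a b : CayleyDickson 3} (ha : a.IsImaginary)
    (hb : b.IsImaginary) (hab : LinearIndependent ℝ ![a, b]) :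
    ∃ R : End ℝ (CayleyDickson 3), finrank ℝ (LinearMap.ker (associatorMap a b)) = 4 ∧
      finrank ℝ (LinearMap.ker R) = 4 ∧ R * associatorMap a b = 0 ∧
      ∀ x, R x = 0 → associatorMap a b (associatorMap a b x) =
        -((2 * ‖a‖ * ‖b‖ * Real.sin (InnerProductGeometry.angle a b)) ^ 2 • x) := by
  have ha0 : a ≠ 0 := hab.ne_zero 0
  have hna : ‖a‖ ^ 2 ≠ 0 := pow_ne_zero 2 (norm_ne_zero_iff.2 ha0)
  -- The Gram–Schmidt coefficient.
  set r : ℝ := -(inner ℝ a b / ‖a‖ ^ 2) with hr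
  have hb0 : b + r • a ≠ 0 := fun h => by
    have := (LinearIndependent.pair_iff.1 hab r 1 (by rw [one_smul, add_comm, h])).2
    exact one_ne_zero this
  have horth : inner ℝ a (b + r • a) = 0 := by
    rw [inner_add_right, real_inner_smul_right, real_inner_self_eq_norm_sq, hr]
    field_simp
    ring
  obtain ⟨R, h1, h2, h3, h4⟩ :=
    associatorMap_spec_of_inner_eq_zero ha (hb.add (ha.smul r)) horth ha0 hb0
  rw [associatorMap_add_smul] at h1 h3 h4
  refine ⟨R, h1, h2, h3, fun x hx => ?_⟩
  rw [h4 x hx]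
  congr 2
  have hcos := InnerProductGeometry.cos_angle_mul_norm_mul_norm a b
  have hsin := Real.sin_sq_add_cos_sq (InnerProductGeometry.angle a b)
  -- Squared area of the parallelogram on `a` and `b`, the source of `sin θ`.
  have hn : ‖a‖ ^ 2 * ‖b + r • a‖ ^ 2 = ‖a‖ ^ 2 * ‖b‖ ^ 2 - inner ℝ a b ^ 2 := by
    rw [norm_add_sq_real, real_inner_smul_right, norm_smul, mul_pow, Real.norm_eq_abs, sq_abs,
      real_inner_comm, hr]
    field_simp
    ring
  rw [hn, ← hcos]
  linear_combination (4 * ‖a‖ ^ 2 * ‖b‖ ^ 2) * (-hsin)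

end CayleyDickson

/-! ### Spectrum of a skew block operator -/

section LinearAlgebra

open Module

variable {V W : Type*} [AddCommGroup V] [Module ℝ V] [AddCommGroup W] [Module ℝ W]

/-- The eigenvector equation of `(x, y) ↦ (x - N⁻¹ T y, y + N⁻¹ T x)`. -/
theorem skew_block_eq_smul_iff (e : (V × V) ≃ₗ[ℝ] W) {D : End ℝ W} {T : End ℝ V} {N : ℝ}
    (hN : N ≠ 0) (hD : ∀ x y, D (e (x, y)) = e (x - (1 / N) • T y, y + (1 / N) • T x))
    (μ : ℝ) (x y : V) :
    D (e (x, y)) = μ • e (x, y) ↔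
      T y = -((N * (μ - 1)) • x) ∧ T x = (N * (μ - 1)) • y := by
  rw [hD, ← map_smul e, e.injective.eq_iff, Prod.smul_mk, Prod.mk_inj]
  have h : ∀ z, T z = N • ((1 / N) • T z) := fun z => by
    rw [smul_smul, mul_one_div_cancel hN, one_smul]
  refine and_congr ⟨fun h1 => ?_, fun h1 => ?_⟩ ⟨fun h1 => ?_, fun h1 => ?_⟩
  · rw [h y]
    linear_combination (norm := module) (-N) • h1
  · rw [h1, smul_neg, smul_smul, ← mul_assoc, one_div_mul_cancel hN]
    module
  · rw [h x]
    linear_combination (norm := module) N • h1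
  · rw [h1, smul_smul, ← mul_assoc, one_div_mul_cancel hN]
    module

/-- The eigenspaces of `(x, y) ↦ (x - N⁻¹ T y, y + N⁻¹ T x)` when `T ^ 2 = -s ^ 2` on the
kernel of `R`, which contains the range of `T`. -/
theorem finrank_eigenspace_of_skew_block (e : (V × V) ≃ₗ[ℝ] W) {D : End ℝ W} {T R : End ℝ V}
    {N s : ℝ} (hN : N ≠ 0) (hs : s ≠ 0)
    (hD : ∀ x y, D (e (x, y)) = e (x - (1 / N) • T y, y + (1 / N) • T x))
    (hRT : R * T = 0) (hR : ∀ x, R x = 0 → T (T x) = -(s ^ 2 • x)) :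
    finrank ℝ (D.eigenspace (1 + s / N)) = finrank ℝ (LinearMap.ker R) := by
  let f : V →ₗ[ℝ] W := e.toLinearMap ∘ₗ LinearMap.prod LinearMap.id ((1 / s) • T)
  have hf : Function.Injective f := fun x y h => congrArg Prod.fst (e.injective h)
  have hTR : ∀ x, R (T x) = 0 := LinearMap.congr_fun hRT
  suffices h : D.eigenspace (1 + s / N) = (LinearMap.ker R).map f by
    rw [h, (Submodule.equivMapOfInjective f hf _).finrank_eq]
  ext w
  obtain ⟨⟨x, y⟩, rfl⟩ := e.surjective w
  rw [End.mem_eigenspace_iff, skew_block_eq_smul_iff e hN hD, add_sub_cancel_left,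
    mul_div_cancel₀ _ hN]
  constructor
  · rintro ⟨h1, h2⟩
    refine ⟨x, ?_, ?_⟩
    -- `s x = -T y` lies in the range of `T`, which `R` kills.
    · have h : s • R x = 0 := by
        rw [← map_smul, ← neg_eq_zero, ← map_neg, ← h1, hTR]
      exact (smul_eq_zero.1 h).resolve_left hs
    · change e (x, (1 / s) • T x) = _
      rw [h2, smul_smul, one_div_mul_cancel hs, one_smul]
  · rintro ⟨z, hz, h⟩
    have h' : (z, (1 / s) • T z) = (x, y) := e.injective h
    obtain ⟨rfl, rfl⟩ := Prod.mk_inj.1 h'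
    rw [map_smul, hR z hz, smul_neg, smul_smul, smul_smul, mul_one_div_cancel hs, one_smul, sq,
      ← mul_assoc, one_div_mul_cancel hs, one_mul]
    exact ⟨rfl, rfl⟩

theorem finrank_eigenspace_one_of_skew_block (e : (V × V) ≃ₗ[ℝ] W) {D : End ℝ W} {T : End ℝ V}
    {N : ℝ} (hN : N ≠ 0)
    (hD : ∀ x y, D (e (x, y)) = e (x - (1 / N) • T y, y + (1 / N) • T x)) [FiniteDimensional ℝ V] :
    finrank ℝ (D.eigenspace 1) = 2 * finrank ℝ (LinearMap.ker T) := by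
  let f : (LinearMap.ker T × LinearMap.ker T) →ₗ[ℝ] W :=
    e.toLinearMap ∘ₗ LinearMap.prodMap (Submodule.subtype _) (Submodule.subtype _)
  have hf : Function.Injective f :=
    e.injective.comp (Subtype.val_injective.prodMap Subtype.val_injective)
  have h : D.eigenspace 1 = LinearMap.range f := by
    ext w
    obtain ⟨⟨x, y⟩, rfl⟩ := e.surjective w
    rw [End.mem_eigenspace_iff, skew_block_eq_smul_iff e hN hD, sub_self, mul_zero, zero_smul,
      neg_zero, zero_smul]
    constructor
    · rintro ⟨hy, hx⟩
      exact ⟨(⟨x, hx⟩, ⟨y, hy⟩), rfl⟩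
    · rintro ⟨⟨⟨z, hz⟩, ⟨w, hw⟩⟩, h⟩
      obtain ⟨rfl, rfl⟩ := Prod.mk_inj.1 (e.injective h)
      exact ⟨hw, hz⟩
  rw [h, LinearMap.finrank_range_of_inj hf, finrank_prod, two_mul]

/-- Applying `T³ = -s² T` to both components of an eigenvector gives `ν(ν² - s²) = 0` for `ν = N(μ -
1)`. -/
theorem eigenvalue_of_skew_block (e : (V × V) ≃ₗ[ℝ] W) {D : End ℝ W} {T : End ℝ V} {N s μ : ℝ}
    (hN : N ≠ 0)
    (hD : ∀ x y, D (e (x, y)) = e (x - (1 / N) • T y, y + (1 / N) • T x))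
    (hT : ∀ x, T (T (T x)) = -(s ^ 2 • T x)) (hμ : D.HasEigenvalue μ) :
    μ = 1 ∨ μ = 1 + s / N ∨ μ = 1 - s / N := by
  obtain ⟨w, hw, hw0⟩ := hμ.exists_hasEigenvector
  obtain ⟨⟨x, y⟩, rfl⟩ := e.surjective w
  rw [End.mem_eigenspace_iff, skew_block_eq_smul_iff e hN hD] at hw
  obtain ⟨h1, h2⟩ := hw
  generalize hν : N * (μ - 1) = ν at h1 h2
  have hx := hT x
  have hy := hT y
  simp only [h1, h2, map_smul, map_neg, smul_neg, neg_neg] at hx hy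
  have hxy : (ν * (ν ^ 2 - s ^ 2)) • ((x, y) : V × V) = 0 := by
    rw [Prod.smul_mk, Prod.mk_eq_zero]
    constructor
    · linear_combination (norm := module) hy
    · linear_combination (norm := module) -hx
  have h0 : ((x, y) : V × V) ≠ 0 := fun h => hw0 (by rw [h, map_zero])
  have h3 := (smul_eq_zero.1 hxy).resolve_right h0
  have hμ : μ = 1 + ν / N := by rw [← hν, mul_div_cancel_left₀ _ hN]; ring
  rcases mul_eq_zero.1 h3 with h | h
  · left; rw [hμ, h]; simp
  · rcases sq_eq_sq_iff_eq_or_eq_neg.1 (sub_eq_zero.1 h) with h | h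
    · right; left; rw [hμ, h]
    · right; right; rw [hμ, h]; ring

end LinearAlgebra

/-! ### The spectrum of `(a, b)` -/

theorem mainTheorem6 (a b : CayleyDickson 3)
    (ha : a.IsImaginary) (hb : b.IsImaginary) (hab : LinearIndependent ℝ ![a, b])
    (θ δ : ℝ) (hθ : θ = InnerProductGeometry.angle a b)
    (hδ : δ = 2 * ‖a‖ * ‖b‖ * Real.sin θ / (‖a‖ ^ 2 + ‖b‖ ^ 2)) :
    (∀ μ : ℝ, (CayleyDickson.pair a b).M.HasEigenvalue μ ↔ μ = 1 ∨ μ = 1 + δ ∨ μ = 1 - δ) ∧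
    Module.finrank ℝ ((CayleyDickson.pair a b).M.eigenspace 1) = 8 ∧
    Module.finrank ℝ ((CayleyDickson.pair a b).M.eigenspace (1 + δ)) = 4 ∧
    Module.finrank ℝ ((CayleyDickson.pair a b).M.eigenspace (1 - δ)) = 4 := by
  obtain ⟨R, hT, hR, hRT, hTT⟩ := CayleyDickson.associatorMap_spec ha hb hab
  rw [← hθ] at hTT
  have hna : 0 < ‖a‖ := norm_pos_iff.2 (hab.ne_zero 0)
  have hnb : 0 < ‖b‖ := norm_pos_iff.2 (hab.ne_zero 1)
  have hN : ‖a‖ ^ 2 + ‖b‖ ^ 2 ≠ 0 := by positivity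
  have hsin : Real.sin θ ≠ 0 := fun h => by
    rw [hθ, InnerProductGeometry.sin_eq_zero_iff_angle_eq_zero_or_angle_eq_pi,
      InnerProductGeometry.angle_eq_zero_iff, InnerProductGeometry.angle_eq_pi_iff] at h
    obtain ⟨r, hr⟩ : ∃ r : ℝ, b = r • a := by
      rcases h with ⟨_, r, _, hr⟩ | ⟨_, r, _, hr⟩ <;> exact ⟨r, hr⟩
    have := (LinearIndependent.pair_iff.1 hab r (-1) (by rw [hr, neg_one_smul, add_neg_cancel])).2
    norm_num at this
  have hs : 2 * ‖a‖ * ‖b‖ * Real.sin θ ≠ 0 := by positivity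
  let e : (CayleyDickson 3 × CayleyDickson 3) ≃ₗ[ℝ] CayleyDickson 4 := LinearEquiv.refl ℝ _
  have hD : ∀ x y, (CayleyDickson.pair a b).M (e (x, y)) = _ := CayleyDickson.M_pair ha hb hN
  have h1 := finrank_eigenspace_one_of_skew_block e hN hD
  rw [hT] at h1
  have h2 := finrank_eigenspace_of_skew_block e hN hs hD hRT hTT
  rw [hR, ← hδ] at h2
  -- The relation on `ker R` involves only `s²`, so `-s` serves equally well.
  have h3 := finrank_eigenspace_of_skew_block e hN (neg_ne_zero.2 hs) hD hRT
    (fun x hx => by rw [neg_sq]; exact hTT x hx)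
  rw [hR, neg_div, ← hδ, ← sub_eq_add_neg] at h3
  refine ⟨fun μ => ⟨fun h => ?_, fun h => ?_⟩, h1, h2, h3⟩
  · rw [hδ]
    exact eigenvalue_of_skew_block e hN hD (fun x => hTT _ (LinearMap.congr_fun hRT x)) h
  · have key : ∀ ν : ℝ, Module.finrank ℝ ((CayleyDickson.pair a b).M.eigenspace ν) ≠ 0 →
        (CayleyDickson.pair a b).M.HasEigenvalue ν := fun ν hν h0 => hν (by
      rw [show Module.End.eigenspace _ ν = ⊥ from h0, finrank_bot])
    rcases h with rfl | rfl | rfl <;> apply key <;> simp only [h1, h2, h3] <;> norm_num
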